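/- Let $B=\mathbb{Z}[\sqrt{-5}]$, let $P=(2,\,1+\sqrt{-5})B$, let $a,b,c\in B$, and let $A=B[X,Y]/(aX^2+bXY+cY^2-1)$. Then: (i) $A$ is smooth over $B$ if and only if $b\notin P$ or $a,b,c\in P$. (ii) $A$ is a regular ring but is not smooth over $B$ if and only if one of the following cases occurs: (1) $a-\sqrt{-5}$, $b$ and $c-\sqrt{-5}$ are all divisible by $2$ in $B$; (2) $a$, $b$ and $c-\sqrt{-5}$ are all divisible by $2$ in $B$; (3) $a-\sqrt{-5}$, $b$ and $c$ are all divisible by $2$ in $B$. -/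

import Mathlib

/-- The ring `B[X, Y] / (a X² + b X Y + c Y² - 1)`, with `X = X 0` and `Y = X 1`. -/
abbrev QuadraticAlgebraXY {B : Type*} [CommRing B] (a b c : B) : Type _ :=
  MvPolynomial (Fin 2) B ⧸
    Ideal.span {MvPolynomial.C a * MvPolynomial.X 0 ^ 2
      + MvPolynomial.C b * MvPolynomial.X 0 * MvPolynomial.X 1
      + MvPolynomial.C c * MvPolynomial.X 1 ^ 2 - (1 : MvPolynomial (Fin 2) B)}

/-- The ideal `P = (2, 1 + √-5)` of `ℤ[√-5]`. -/
def idealP : Ideal (Zsqrtd (-5)) :=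
  Ideal.span {2, 1 + Zsqrtd.sqrtd}

/-! Write `f` for the equation, `π = 1 + √-5` and `P = (2, π)`; then `P ^ 2 = (2)` and `B / P = 𝔽₂`.

Smoothness: by Euler's relation the ideal of the partial derivatives in `A` contains `2`, so only
`P` matters. If `b ∉ P`, then `b` is a unit modulo `2` and the Jacobian ideal is everything; if `a,
b, c ∈ P`, then the fibre over `P` is empty (`smooth_of_idealP`). Otherwise the form modulo `P` is a
diagonal form in characteristic two taking the value `1`, and a tangent vector at a point of the
fibre fails to lift to second order (`not_smooth_of_charTwo`).

Regularity: `B[X, Y]` is a regular domain, so `A` is singular exactly where `f` lies in the square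
of the maximal ideal of the local ring. Modulo `2` one has `f = g ^ 2 + π q`, with `g` affine linear
and `q` a quadratic form. Points over `P` with `g = q = 0` are singular
(`not_isRegularRing_of_point`). Avoiding them forces `q` to be a nonzero constant on the line `g =
0`, which leaves the three listed cases (`dvd_of_isRegularRing`). In these cases `f` is not in the
square because `π` is not (`mem_of_mul_C_mem_sq`); derivations over `B` kill `π`, so a lift of
Frobenius is used instead. -/

open IsLocalRing

universe u

/-! ### Hypersurfaces in regular rings. -/

/-- Factoring out an element of `𝔪 \ 𝔪²` lowers the number of generators of the maximal ideal. -/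
lemma spanFinrank_maximalIdeal_add_one_le {S T : Type*} [CommRing S] [CommRing T] [IsLocalRing S]
    [IsNoetherianRing S] [IsLocalRing T] (φ : S →+* T) (hφ : Function.Surjective φ)
    {f : S} (hf : f ∈ maximalIdeal S) (hf2 : f ∉ maximalIdeal S ^ 2) (h0 : φ f = 0) :
    (maximalIdeal T).spanFinrank + 1 ≤ (maximalIdeal S).spanFinrank := by
  classical
  obtain ⟨s, hs, hspan⟩ :=
    Submodule.FG.exists_span_finset_card_eq_spanFinrank (maximalIdeal S).fg_of_isNoetherianRing
  have hmem : ∀ x ∈ s, x ∈ maximalIdeal S := fun x hx ↦ hspan ▸ Submodule.subset_span hx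
  obtain ⟨a, -, ha⟩ := Submodule.mem_span_finset.mp (hspan ▸ hf)
  -- Some coefficient of `f` in the minimal generators is a unit, as otherwise `f ∈ 𝔪 ^ 2`; modulo
  -- `f` the corresponding generator is redundant.
  obtain ⟨j, hj, hu⟩ : ∃ j ∈ s, IsUnit (a j) := by
    by_contra! hcon
    refine hf2 (ha ▸ Ideal.sum_mem _ fun x hx ↦ ?_)
    rw [pow_two, smul_eq_mul]
    exact Ideal.mul_mem_mul ((mem_maximalIdeal _).mpr (hcon x hx)) (hmem x hx)
  have hmap : (maximalIdeal S).map φ = maximalIdeal T :=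
    IsLocalRing.map_maximalIdeal_of_surjective φ hφ
  have hle : maximalIdeal T = Ideal.span (((s.erase j).image φ : Finset T) : Set T) := by
    apply le_antisymm
    · rw [← hmap, ← hspan, Ideal.map_le_iff_le_comap]
      refine Ideal.span_le.mpr fun x hx ↦ ?_
      have hne : ∀ y ∈ s.erase j, φ y ∈ Ideal.span (((s.erase j).image φ : Finset T) : Set T) :=
        fun y hy ↦ Ideal.subset_span (Finset.mem_coe.mpr (Finset.mem_image_of_mem φ hy))
      by_cases hxj : x = j
      · subst hxj
        have h1 := congrArg φ ha
        rw [h0, ← Finset.add_sum_erase s _ hj, map_add, map_sum] at h1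
        have h2 : φ (a x) * φ x = - ∑ y ∈ s.erase x, φ (a y • y) := by
          rw [eq_neg_iff_add_eq_zero, ← map_mul]; exact h1
        rw [SetLike.mem_coe, Ideal.mem_comap, ← Ideal.unit_mul_mem_iff_mem _ (hu.map φ)]
        rw [h2]
        refine neg_mem (Ideal.sum_mem _ fun y hy ↦ ?_)
        rw [smul_eq_mul, map_mul]
        exact Ideal.mul_mem_left _ _ (hne y hy)
      · exact hne x (Finset.mem_erase.mpr ⟨hxj, hx⟩)
    · refine Ideal.span_le.mpr fun x hx ↦ ?_
      obtain ⟨y, hy, rfl⟩ := Finset.mem_image.mp hx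
      exact hmap ▸ Ideal.mem_map_of_mem φ (hmem y (Finset.mem_of_mem_erase hy))
  have h1 : (maximalIdeal T).spanFinrank ≤ ((s.erase j).image φ).card := by
    rw [hle, ← Set.ncard_coe_finset]
    exact Submodule.spanFinrank_span_le_ncard_of_finite (Finset.finite_toSet _)
  have h2 := Finset.card_image_le (s := s.erase j) (f := φ)
  have h3 := Finset.card_erase_add_one hj
  omega

/-- Dividing by `f` lowers the dimension by at most one and the number of generators of the maximal
ideal by at least one, so the latter is still bounded by the dimension. -/
lemma IsRegularLocalRing.of_surjective_of_ker_eq_span {S T : Type*} [CommRing S] [CommRing T]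
    [IsRegularLocalRing S] [IsLocalRing T] (φ : S →+* T) (hφ : Function.Surjective φ)
    {f : S} (hf : f ∈ maximalIdeal S) (hf2 : f ∉ maximalIdeal S ^ 2)
    (hker : RingHom.ker φ = Ideal.span {f}) : IsRegularLocalRing T := by
  have := isNoetherianRing_of_surjective S T φ hφ
  have h0 : φ f = 0 := (RingHom.mem_ker).mp (hker ▸ Ideal.mem_span_singleton_self f)
  have h1 := spanFinrank_maximalIdeal_add_one_le φ hφ hf hf2 h0
  have h2 := (isRegularLocalRing_iff S).mp inferInstance
  apply IsRegularLocalRing.of_spanFinrank_maximalIdeal_le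
  have e : S ⧸ Ideal.span {f} ≃+* T :=
    (Ideal.quotEquivOfEq hker.symm).trans (RingHom.quotientKerEquivOfSurjective hφ)
  have h3 : ringKrullDim S ≤ ringKrullDim T + 1 := by
    have := ringKrullDim_le_ringKrullDim_quotient_add_card (R := S) {f}
      (by simpa [ringJacobson_eq_maximalIdeal] using hf)
    rw [Finset.coe_singleton, ringKrullDim_eq_of_ringEquiv e] at this
    simpa using this
  rw [← h2] at h3
  have h4 : (((maximalIdeal T).spanFinrank + 1 : ℕ) : WithBot ℕ∞) ≤ ringKrullDim T + 1 :=
    le_trans (by exact_mod_cast h1) h3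
  push_cast at h4
  generalize ringKrullDim T = d at *
  induction d with
  | bot => simp at h4
  | coe d => 
    norm_cast at h4 ⊢
    exact (ENat.add_le_add_iff_right (by simp)).mp h4

/-- The dimension drops, since `f` is a nonzerodivisor, but by Nakayama the number of generators of
the maximal ideal does not: lifts of generators generate modulo `f`, hence modulo `𝔪 ^ 2`. -/
lemma not_isRegularLocalRing_of_mem_maximalIdeal_sq {S T : Type*} [CommRing S] [IsDomain S]
    [CommRing T] [IsRegularLocalRing S] [IsLocalRing T] (φ : S →+* T) (hφ : Function.Surjective φ)
    {f : S} (hf0 : f ≠ 0) (hf2 : f ∈ maximalIdeal S ^ 2)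
    (hker : RingHom.ker φ = Ideal.span {f}) : ¬ IsRegularLocalRing T := by
  classical
  intro hT
  have hS := (isRegularLocalRing_iff S).mp inferInstance
  have hT' := (isRegularLocalRing_iff T).mp inferInstance
  have e : S ⧸ Ideal.span {f} ≃+* T :=
    (Ideal.quotEquivOfEq hker.symm).trans (RingHom.quotientKerEquivOfSurjective hφ)
  have hdim := ringKrullDim_quotient_succ_le_of_nonZeroDivisor (mem_nonZeroDivisors_of_ne_zero hf0)
  rw [ringKrullDim_eq_of_ringEquiv e, ← hS, ← hT'] at hdim
  have hdim' : (maximalIdeal T).spanFinrank + 1 ≤ (maximalIdeal S).spanFinrank := by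
    exact_mod_cast hdim
  obtain ⟨s, hs, hspan⟩ :=
    Submodule.FG.exists_span_finset_card_eq_spanFinrank (maximalIdeal T).fg_of_isNoetherianRing
  choose ψ hψ using hφ
  have hloc : IsLocalHom φ := IsLocalHom.of_surjective φ fun x ↦ ⟨ψ x, hψ x⟩
  have hle : maximalIdeal S ≤ Ideal.span ((s.image ψ : Finset S) : Set S) := by
    refine Submodule.le_of_le_smul_of_le_jacobson_bot (I := maximalIdeal S)
      (maximalIdeal S).fg_of_isNoetherianRing (IsLocalRing.maximalIdeal_le_jacobson _) ?_
    intro x hx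
    have hφx : φ x ∈ (Ideal.span ((s.image ψ : Finset S) : Set S)).map φ := by
      have : φ x ∈ maximalIdeal T := by
        rw [mem_maximalIdeal] at hx ⊢
        exact fun h ↦ hx (isUnit_of_map_unit φ x h)
      rw [← hspan] at this
      rw [Ideal.map_span, Finset.coe_image, ← Set.image_comp]
      convert this
      simp [hψ]
    obtain ⟨y, hy, hyx⟩ := (Ideal.mem_map_iff_of_surjective φ fun x ↦ ⟨ψ x, hψ x⟩).mp hφx
    have hxy : x - y ∈ Ideal.span {f} := hker ▸ (RingHom.mem_ker.mpr (by simp [hyx]))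
    have : x = y + (x - y) := by ring
    rw [this]
    refine Submodule.add_mem_sup hy ?_
    rw [smul_eq_mul, ← pow_two]
    exact (Ideal.span_singleton_le_iff_mem _).mpr hf2 hxy
  have heq : maximalIdeal S = Ideal.span ((s.image ψ : Finset S) : Set S) := by
    refine le_antisymm hle (Ideal.span_le.mpr fun x hx ↦ ?_)
    obtain ⟨y, hy, rfl⟩ := Finset.mem_image.mp hx
    have : y ∈ maximalIdeal T := hspan ▸ Submodule.subset_span hy
    rw [mem_maximalIdeal] at this
    refine (mem_maximalIdeal _).mpr fun h ↦ this ?_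
    simpa [hψ] using h.map φ
  have h1 : (maximalIdeal S).spanFinrank ≤ (s.image ψ).card := by
    rw [heq, ← Set.ncard_coe_finset]
    exact Submodule.spanFinrank_span_le_ncard_of_finite (Finset.finite_toSet _)
  have h2 := Finset.card_image_le (s := s) (f := ψ)
  omega

lemma Localization.ker_localRingHom_of_surjective {R S : Type*} [CommRing R] [CommRing S]
    (φ : R →+* S) (hφ : Function.Surjective φ) {f : R} (hker : RingHom.ker φ = Ideal.span {f})
    (P : Ideal S) [P.IsPrime] :
    RingHom.ker (Localization.localRingHom (P.comap φ) P φ rfl) =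
      Ideal.span {algebraMap R (Localization.AtPrime (P.comap φ)) f} := by
  have h0 : φ f = 0 := (RingHom.mem_ker).mp (hker ▸ Ideal.mem_span_singleton_self f)
  apply le_antisymm
  · intro x hx
    obtain ⟨⟨r, s⟩, rfl⟩ := IsLocalization.mk'_surjective (P.comap φ).primeCompl x
    rw [RingHom.mem_ker, Localization.localRingHom_mk', IsLocalization.mk'_eq_zero_iff] at hx
    obtain ⟨⟨m, hm⟩, hmr⟩ := hx
    obtain ⟨v, rfl⟩ := hφ m
    have hv : v * r ∈ Ideal.span {f} := hker ▸ RingHom.mem_ker.mpr (by simpa using hmr)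
    have hv' := Ideal.mem_map_of_mem (algebraMap R (Localization.AtPrime (P.comap φ))) hv
    rw [Ideal.map_span, Set.image_singleton, map_mul] at hv'
    have hvu : IsUnit (algebraMap R (Localization.AtPrime (P.comap φ)) v) :=
      IsLocalization.map_units _ (⟨v, hm⟩ : (P.comap φ).primeCompl)
    rw [Ideal.unit_mul_mem_iff_mem _ hvu] at hv'
    dsimp only
    rw [IsLocalization.mk'_eq_mul_mk'_one]
    exact Ideal.mul_mem_right _ _ hv'
  · rw [Ideal.span_singleton_le_iff_mem, RingHom.mem_ker, Localization.localRingHom_to_map, h0,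
      map_zero]

/-- Clearing denominators turns the local condition into one about `p ^ 2` in the global ring, where
it can be tested with derivations and ring maps. -/
lemma Localization.AtPrime.algebraMap_mem_maximalIdeal_sq_iff {R : Type*} [CommRing R]
    (p : Ideal R) [p.IsPrime] (f : R) :
    algebraMap R (Localization.AtPrime p) f ∈ maximalIdeal (Localization.AtPrime p) ^ 2 ↔
      ∃ s ∉ p, s * f ∈ p ^ 2 := by
  rw [← Localization.AtPrime.map_eq_maximalIdeal, ← Ideal.map_pow,
    IsLocalization.algebraMap_mem_map_algebraMap_iff p.primeCompl]
  rfl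

/-- A hypersurface in a regular ring is regular if its equation does not lie in the square of the
maximal ideal of the local ring at any of its points. -/
theorem IsRegularRing.of_surjective_of_ker_eq_span {R S : Type u} [CommRing R] [CommRing S]
    [IsRegularRing R] (φ : R →+* S) (hφ : Function.Surjective φ) {f : R}
    (hker : RingHom.ker φ = Ideal.span {f})
    (h : ∀ p : Ideal R, p.IsPrime → f ∈ p → ∀ s, s * f ∈ p ^ 2 → s ∈ p) : IsRegularRing S := by
  have := isNoetherianRing_of_surjective R S φ hφ
  rw [isRegularRing_iff]
  intro P hP
  have h0 : φ f = 0 := (RingHom.mem_ker).mp (hker ▸ Ideal.mem_span_singleton_self f)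
  have hfp : f ∈ P.comap φ := by simp [h0]
  refine IsRegularLocalRing.of_surjective_of_ker_eq_span (Localization.localRingHom _ P φ rfl)
    (RingHom.surjective_localRingHom_of_surjective φ hφ P) ?_ ?_
    (Localization.ker_localRingHom_of_surjective φ hφ hker P)
  · exact (IsLocalization.AtPrime.to_map_mem_maximal_iff _ (P.comap φ) f).mpr hfp
  · rw [Localization.AtPrime.algebraMap_mem_maximalIdeal_sq_iff]
    rintro ⟨s, hs, hsf⟩
    exact hs (h _ inferInstance hfp s hsf)

/-- A hypersurface in a regular domain is not regular if its equation lies in the square of a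
prime ideal. -/
theorem not_isRegularRing_of_mem_sq {R S : Type u} [CommRing R] [IsDomain R] [CommRing S]
    [IsRegularRing R] (φ : R →+* S) (hφ : Function.Surjective φ) {f : R} (hf0 : f ≠ 0)
    (hker : RingHom.ker φ = Ideal.span {f}) (p : Ideal R) [p.IsPrime] (hfp : f ∈ p ^ 2) :
    ¬ IsRegularRing S := by
  intro hS
  have hle : RingHom.ker φ ≤ p := by
    rw [hker, Ideal.span_singleton_le_iff_mem]
    exact Ideal.pow_le_self two_ne_zero hfp
  have hP : (p.map φ).IsPrime := Ideal.map_isPrime_of_surjective hφ hle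
  have hcomap : (p.map φ).comap φ = p := by
    rw [Ideal.comap_map_of_surjective' φ hφ, sup_eq_left.mpr hle]
  refine not_isRegularLocalRing_of_mem_maximalIdeal_sq
    (Localization.localRingHom _ (p.map φ) φ rfl)
    (RingHom.surjective_localRingHom_of_surjective φ hφ _) ?_ ?_
    (Localization.ker_localRingHom_of_surjective φ hφ hker _) inferInstance
  · intro h
    exact hf0 ((IsLocalization.to_map_eq_zero_iff _
      (Ideal.primeCompl_le_nonZeroDivisors ((p.map φ).comap φ))).mp h)
  · rw [Localization.AtPrime.algebraMap_mem_maximalIdeal_sq_iff]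
    exact ⟨1, (Ideal.ne_top_iff_one _).mp (hP.comap φ).ne_top, by rwa [hcomap, one_mul]⟩

/-! ### Regularity of `ℤ[√-5]`. -/

section PolynomialInt

open Polynomial

/-- Here `p = (q, X - m)`. Evaluation at `m` sends `p ^ 2` into `(q ^ 2)`, while `f(m)` is divisible
by `q` exactly once; hence `q ∣ s(m)`, that is, `s ∈ p`. -/
lemma Polynomial.mem_of_mul_mem_sq_of_prime {p : Ideal ℤ[X]} (hp : p.IsPrime) {q m : ℤ}
    (hq : Prime q) (hqp : C q ∈ p) (hm : X - C m ∈ p) {f s : ℤ[X]}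
    (hqf : q ∣ f.eval m) (hf : ¬ q ^ 2 ∣ f.eval m) (h : s * f ∈ p ^ 2) : s ∈ p := by
  have key : ∀ g : ℤ[X], g ∈ p ↔ C (g.eval m) ∈ p := fun g ↦ by
    have h1 : g - C (g.eval m) ∈ p :=
      Ideal.mem_of_dvd _ (X_sub_C_dvd_sub_C_eval) hm
    constructor
    · intro hg; simpa using sub_mem hg h1
    · intro hg; simpa using add_mem h1 hg
  have hle : p ≤ (Ideal.span {q}).comap (evalRingHom m) := fun g hg ↦ by
    rw [Ideal.mem_comap, coe_evalRingHom, Ideal.mem_span_singleton]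
    by_contra hd
    obtain ⟨u, v, huv⟩ := (hq.coprime_iff_not_dvd).mpr hd
    refine hp.ne_top ((Ideal.eq_top_iff_one _).mpr ?_)
    have h1 := add_mem (p.mul_mem_left (C u) hqp) (p.mul_mem_left (C v) ((key g).mp hg))
    rwa [← C_mul, ← C_mul, ← C_add, huv, C_1] at h1
  have h2 := Ideal.le_comap_pow (K := Ideal.span {q}) (evalRingHom m) 2 (Ideal.pow_right_mono hle 2 h)
  rw [Ideal.mem_comap, Ideal.span_singleton_pow, Ideal.mem_span_singleton, coe_evalRingHom,
    eval_mul] at h2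
  obtain ⟨u, hu⟩ := hqf
  rw [hu, pow_two, mul_dvd_mul_iff_left hq.ne_zero] at hf
  rw [hu, mul_left_comm, pow_two, mul_dvd_mul_iff_left hq.ne_zero] at h2
  obtain ⟨v, hv⟩ := (hq.dvd_or_dvd h2).resolve_right hf
  rw [key, hv, C_mul]
  exact p.mul_mem_right _ hqp

end PolynomialInt

namespace Zsqrtd

instance isDomain_neg_five : IsDomain (Zsqrtd (-5)) :=
  have : NoZeroDivisors (Zsqrtd (-5)) := ⟨fun {a b} h ↦ by
    have h1 := congrArg norm h
    rw [norm_mul, norm_zero, mul_eq_zero] at h1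
    simpa only [norm_eq_zero_iff (show (-5 : ℤ) < 0 by norm_num)] using h1⟩
  NoZeroDivisors.to_isDomain _

open Polynomial in
/-- The ring `ℤ[√-5]` is regular. -/
instance isRegularRing_neg_five : IsRegularRing (Zsqrtd (-5)) := by
  let φ : ℤ[X] →+* Zsqrtd (-5) := eval₂RingHom (Int.castRingHom _) sqrtd
  have hX : φ X = sqrtd := by simp [φ]
  have hC : ∀ a : ℤ, φ (C a) = a := fun a ↦ by simp [φ]
  have hsq : (sqrtd : Zsqrtd (-5)) ^ 2 = -5 := by ext <;> simp [pow_two]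
  have hlin : ∀ a b : ℤ, φ (C a + C b * X) = ⟨a, b⟩ := fun a b ↦ by
    rw [map_add, map_mul, hC, hC, hX]; ext <;> simp
  have hf0 : φ (X ^ 2 + C 5) = 0 := by
    rw [map_add, map_pow, hX, hC, hsq]; norm_num
  have hmonic : (X ^ 2 + C 5 : ℤ[X]).Monic := monic_X_pow_add_C _ two_ne_zero
  refine IsRegularRing.of_surjective_of_ker_eq_span φ (f := X ^ 2 + C 5)
    (fun x ↦ ⟨C x.re + C x.im * X, hlin _ _⟩) (_root_.le_antisymm (fun g hg ↦ ?_) ?_) ?_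
  · have h1 := modByMonic_add_div g (X ^ 2 + C 5)
    have hdeg : (g %ₘ (X ^ 2 + C 5)).degree ≤ 1 := by
      have := degree_modByMonic_lt g hmonic
      rw [degree_X_pow_add_C (by norm_num)] at this
      exact Order.le_of_lt_succ this
    obtain ⟨b, a, hab⟩ : ∃ b a, g %ₘ (X ^ 2 + C 5) = C b * X + C a := ⟨_, _, eq_X_add_C_of_degree_le_one hdeg⟩
    have h2 : φ (g %ₘ (X ^ 2 + C 5)) = 0 := by
      have := congrArg φ h1
      rwa [map_add, map_mul, hf0, zero_mul, add_zero, RingHom.mem_ker.mp hg] at this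
    rw [hab, add_comm, hlin] at h2
    have ha : a = 0 := congrArg re h2
    have hb : b = 0 := congrArg im h2
    rw [Ideal.mem_span_singleton, ← h1, hab, ha, hb]
    simp
  · rwa [Ideal.span_singleton_le_iff_mem, RingHom.mem_ker]
  · intro p hp hfp s hs
    by_contra hsp
    -- At a singular prime the derivative vanishes, so the prime lies over `2` or contains `X`.
    have hder : C 2 * X ∈ p := by
      have h1 : derivative (s * (X ^ 2 + C 5)) ∈ p := by
        rw [pow_two] at hs
        refine Submodule.mul_induction_on hs (fun u hu v hv ↦ ?_) fun u v hu hv ↦ ?_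
        · rw [derivative_mul]
          exact add_mem (p.mul_mem_left _ hv) (p.mul_mem_right _ hu)
        · rw [derivative_add]; exact add_mem hu hv
      rw [derivative_mul] at h1
      have h2 := (Submodule.add_mem_iff_right _ (p.mul_mem_left (derivative s) hfp)).mp h1
      simpa using (hp.mem_or_mem h2).resolve_left hsp
    rcases hp.mem_or_mem hder with h2 | hX
    -- Here `p = (2, X + 1)`, and the value `6` at `-1` is not divisible by `4`.
    · refine hsp (mem_of_mul_mem_sq_of_prime hp Int.prime_two h2 (m := -1) ?_ ?_ ?_ hs)
      · refine hp.mem_of_pow_mem 2 ?_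
        have : (X - C (-1) : ℤ[X]) ^ 2 = (X ^ 2 + C 5) + C 2 * (X - 2) := by
          simp only [map_neg, map_one, map_ofNat]; ring
        rw [this]
        exact add_mem hfp (p.mul_mem_right _ h2)
      · norm_num
      · norm_num
    -- Here `p = (5, X)`, and the value `5` at `0` is not divisible by `25`.
    · refine hsp (mem_of_mul_mem_sq_of_prime hp (q := 5) (m := 0) ?_ ?_ (by simpa using hX) ?_ ?_ hs)
      · exact Nat.prime_iff_prime_int.mp (by norm_num)
      · exact (Submodule.add_mem_iff_right _ (by rw [pow_two]; exact p.mul_mem_left _ hX)).mp hfp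
      · norm_num
      · norm_num

end Zsqrtd

/-! ### Points of the conic and infinitesimal lifting. -/

namespace QuadraticAlgebraXY

variable {B : Type*} [CommRing B] {a b c : B}

variable (a b c) in
/-- The class of the first variable. -/
noncomputable def x : QuadraticAlgebraXY a b c := Ideal.Quotient.mk _ (MvPolynomial.X 0)

variable (a b c) in
/-- The class of the second variable. -/
noncomputable def y : QuadraticAlgebraXY a b c := Ideal.Quotient.mk _ (MvPolynomial.X 1)

variable (a b c) in
lemma algebraMap_eq_mk (r : B) : algebraMap B (QuadraticAlgebraXY a b c) r =
    Ideal.Quotient.mk _ (MvPolynomial.C r) := rfl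

variable (a b c) in
lemma equation : algebraMap B (QuadraticAlgebraXY a b c) a * x a b c ^ 2 +
    algebraMap B _ b * x a b c * y a b c + algebraMap B _ c * y a b c ^ 2 = 1 := by
  simp only [algebraMap_eq_mk, x, y, ← map_pow, ← map_mul, ← map_add]
  rw [← map_one (Ideal.Quotient.mk _), Ideal.Quotient.eq]
  exact Ideal.mem_span_singleton_self _

variable {E : Type*} [CommRing E] [Algebra B E]

/-- The algebra homomorphism given by a solution of the equation. -/
noncomputable def lift (u v : E) (h : algebraMap B E a * u ^ 2 + algebraMap B E b * u * v +
    algebraMap B E c * v ^ 2 = 1) : QuadraticAlgebraXY a b c →ₐ[B] E :=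
  Ideal.Quotient.liftₐ _ (MvPolynomial.aeval ![u, v]) fun p hp ↦ by
    obtain ⟨q, rfl⟩ := Ideal.mem_span_singleton.mp hp
    rw [map_mul]
    simp [h]

@[simp]
lemma lift_x (u v : E) (h : algebraMap B E a * u ^ 2 + algebraMap B E b * u * v +
    algebraMap B E c * v ^ 2 = 1) : lift u v h (x a b c) = u := by
  change MvPolynomial.aeval ![u, v] (MvPolynomial.X 0) = u
  simp

@[simp]
lemma lift_y (u v : E) (h : algebraMap B E a * u ^ 2 + algebraMap B E b * u * v +
    algebraMap B E c * v ^ 2 = 1) : lift u v h (y a b c) = v := by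
  change MvPolynomial.aeval ![u, v] (MvPolynomial.X 1) = v
  simp

lemma algHom_ext {g g' : QuadraticAlgebraXY a b c →ₐ[B] E} (hx : g (x a b c) = g' (x a b c))
    (hy : g (y a b c) = g' (y a b c)) : g = g' := by
  apply Ideal.Quotient.algHom_ext
  apply MvPolynomial.algHom_ext
  intro i
  fin_cases i
  · exact hx
  · exact hy

lemma equation_map (g : QuadraticAlgebraXY a b c →ₐ[B] E) :
    algebraMap B E a * g (x a b c) ^ 2 + algebraMap B E b * g (x a b c) * g (y a b c) +
      algebraMap B E c * g (y a b c) ^ 2 = 1 := by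
  simpa using congrArg g (equation a b c)

/-- The Jacobian criterion for the algebra of a binary quadratic form. -/
lemma smooth_of_jacobian {α β : QuadraticAlgebraXY a b c}
    (h : α * (2 * algebraMap B _ a * x a b c + algebraMap B _ b * y a b c) +
      β * (algebraMap B _ b * x a b c + 2 * algebraMap B _ c * y a b c) = 1) :
    Algebra.Smooth B (QuadraticAlgebraXY a b c) where
  finitePresentation := Algebra.FinitePresentation.quotient ⟨{_}, by simp; rfl⟩
  formallySmooth := by
    refine Algebra.FormallySmooth.of_comp_surjective fun E _ _ I hI g ↦ ?_
    obtain ⟨u, hu⟩ := Ideal.Quotient.mk_surjective (g (x a b c))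
    obtain ⟨v, hv⟩ := Ideal.Quotient.mk_surjective (g (y a b c))
    obtain ⟨p, hp⟩ := Ideal.Quotient.mk_surjective (g α)
    obtain ⟨q, hq⟩ := Ideal.Quotient.mk_surjective (g β)
    have hmul : ∀ r ∈ I, ∀ s ∈ I, r * s = 0 := fun r hr s hs ↦ by
      have := Ideal.mul_mem_mul hr hs
      rwa [← pow_two, hI, Ideal.mem_bot] at this
    have halg : ∀ r : B, algebraMap B (E ⧸ I) r = Ideal.Quotient.mk I (algebraMap B E r) :=
      fun _ ↦ rfl
    have he := equation_map g
    have hj := congrArg g h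
    simp only [map_add, map_mul, map_ofNat, AlgHom.commutes, map_one, halg, ← hu, ← hv, ← hp,
      ← hq] at hj he
    set A := algebraMap B E a
    set D := algebraMap B E b
    set C := algebraMap B E c
    set e := A * u ^ 2 + D * u * v + C * v ^ 2 - 1 with hedef
    have heI : e ∈ I := by
      rw [← Ideal.Quotient.eq_zero_iff_mem, hedef]
      simp only [map_sub, map_add, map_mul, map_pow, map_one, he, sub_self]
    have hjI : p * (2 * A * u + D * v) + q * (D * u + 2 * C * v) - 1 ∈ I := by
      rw [← Ideal.Quotient.eq_zero_iff_mem]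
      simp only [map_sub, map_add, map_mul, map_one, map_ofNat, hj, sub_self]
    have h1 := hmul _ heI _ hjI
    have h2 := hmul _ heI _ heI
    -- A Newton step: the error `e` has square zero, and the Jacobian relation, valid modulo `I`,
    -- makes the first-order correction cancel it.
    refine ⟨lift (u - p * e) (v - q * e) ?_, algHom_ext ?_ ?_⟩
    · linear_combination (-1 : E) * h1 + (A * p ^ 2 + D * p * q + C * q ^ 2) * h2 + hedef
    · simp only [AlgHom.comp_apply, lift_x, Ideal.Quotient.mkₐ_eq_mk, ← hu]
      rw [Ideal.Quotient.eq]
      simpa using I.mul_mem_left p heI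
    · simp only [AlgHom.comp_apply, lift_y, Ideal.Quotient.mkₐ_eq_mk, ← hv]
      rw [Ideal.Quotient.eq]
      simpa using I.mul_mem_left q heI

/-- Modulo `t ^ 2` the point `(u (1 + t), v (1 + t))` solves the equation. In characteristic two
with `b = 0`, changing it by multiples of `t ^ 2` does not alter the value `(1 + t) ^ 2 = 1 + t ^
2`, so a lift exists only if `t ^ 2 = 0`. -/
lemma sq_eq_zero_of_smooth [Algebra.Smooth B (QuadraticAlgebraXY a b c)] (h2 : (2 : E) = 0)
    (hb : algebraMap B E b = 0) {u v t : E}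
    (h : algebraMap B E a * u ^ 2 + algebraMap B E c * v ^ 2 = 1) (ht : t ^ 3 = 0) :
    t ^ 2 = 0 := by
  let I : Ideal E := Ideal.span {t ^ 2}
  have hI : I ^ 2 = ⊥ := by
    rw [Ideal.span_singleton_pow, Ideal.span_singleton_eq_bot]
    linear_combination t * ht
  let π : E →ₐ[B] E ⧸ I := Ideal.Quotient.mkₐ B I
  have hπ : π (t ^ 2) = 0 := Ideal.Quotient.eq_zero_iff_mem.mpr (Ideal.mem_span_singleton_self _)
  have hsol : algebraMap B (E ⧸ I) a * π (u * (1 + t)) ^ 2 +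
      algebraMap B (E ⧸ I) b * π (u * (1 + t)) * π (v * (1 + t)) +
      algebraMap B (E ⧸ I) c * π (v * (1 + t)) ^ 2 = 1 := by
    simp only [← π.commutes, ← map_pow, ← map_mul, ← map_add]
    rw [← map_one π, hb, ← sub_eq_zero, ← map_sub, ← hπ]
    congr 1
    linear_combination (1 + t) ^ 2 * h + t * h2
  obtain ⟨g, hg⟩ := Algebra.FormallySmooth.comp_surjective B (QuadraticAlgebraXY a b c) I hI
    (lift _ _ hsol)
  have hgx := DFunLike.congr_fun hg (x a b c)
  have hgy := DFunLike.congr_fun hg (y a b c)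
  rw [lift_x, AlgHom.comp_apply, Ideal.Quotient.mkₐ_eq_mk] at hgx
  rw [lift_y, AlgHom.comp_apply, Ideal.Quotient.mkₐ_eq_mk] at hgy
  obtain ⟨p, hp⟩ := Ideal.mem_span_singleton.mp (Ideal.Quotient.eq.mp hgx)
  obtain ⟨q, hq⟩ := Ideal.mem_span_singleton.mp (Ideal.Quotient.eq.mp hgy)
  have he := equation_map g
  rw [hb, sub_eq_iff_eq_add.mp hp, sub_eq_iff_eq_add.mp hq] at he
  linear_combination he - (1 + t) ^ 2 * h - t * h2
    - (algebraMap B E a * (u * (1 + t) * t ^ 2 * p)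
      + algebraMap B E c * (v * (1 + t) * t ^ 2 * q)) * h2
    - (algebraMap B E a * t * p ^ 2 + algebraMap B E c * t * q ^ 2) * ht

/-- If a residue field of characteristic two kills `b`, and the quadratic form takes the value `1`
over it, then the algebra is not smooth. -/
lemma not_smooth_of_charTwo (K : Type*) [Field K] [CharP K 2] [Algebra B K]
    (hb : algebraMap B K b = 0) {x₀ y₀ : K}
    (h : algebraMap B K a * x₀ ^ 2 + algebraMap B K c * y₀ ^ 2 = 1) :
    ¬ Algebra.Smooth B (QuadraticAlgebraXY a b c) := by
  intro hsm
  -- In `K[X] / (X ^ 3)` the class of `X` has cube zero but nonzero square.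
  let J : Ideal (Polynomial K) := Ideal.span {Polynomial.X ^ 3}
  have halg : ∀ r : B, algebraMap B (Polynomial K ⧸ J) r =
      algebraMap K (Polynomial K ⧸ J) (algebraMap B K r) :=
    fun r ↦ IsScalarTower.algebraMap_apply B K (Polynomial K ⧸ J) r
  have h2 := congrArg (algebraMap K (Polynomial K ⧸ J)) (CharTwo.two_eq_zero (R := K))
  rw [map_ofNat, map_zero] at h2
  have ht := sq_eq_zero_of_smooth (a := a) (b := b) (c := c) (E := Polynomial K ⧸ J) h2
    (u := algebraMap K _ x₀) (v := algebraMap K _ y₀) (t := Ideal.Quotient.mk J Polynomial.X)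
    (by rw [halg, hb, map_zero])
    (by simpa [← halg] using congrArg (algebraMap K (Polynomial K ⧸ J)) h)
    (by
      rw [← map_pow, Ideal.Quotient.eq_zero_iff_mem]
      exact Ideal.mem_span_singleton_self _)
  rw [← map_pow, Ideal.Quotient.eq_zero_iff_mem, Ideal.mem_span_singleton,
    Polynomial.X_pow_dvd_iff] at ht
  simpa using ht 2 (by norm_num)

end QuadraticAlgebraXY

/-! ### Arithmetic of the prime `P`. -/

namespace Zsqrtd

lemma mem_idealP_iff (z : Zsqrtd (-5)) : z ∈ idealP ↔ Even (z.re + z.im) := by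
  rw [idealP, Ideal.mem_span_pair]
  constructor
  · rintro ⟨u, v, rfl⟩
    refine ⟨u.re + u.im - 2 * v.im + v.re, ?_⟩
    simp
    ring
  · rintro ⟨k, hk⟩
    refine ⟨(k - z.im : ℤ), (z.im : ℤ), ?_⟩
    ext
    · simp; linarith
    · simp

/-- The residue map `ℤ[√-5] → 𝔽₂` at `P`. -/
def toZModTwo : Zsqrtd (-5) →+* ZMod 2 := Zsqrtd.lift ⟨1, by decide⟩

lemma toZModTwo_eq_zero_iff (z : Zsqrtd (-5)) : toZModTwo z = 0 ↔ z ∈ idealP := by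
  have : toZModTwo z = ((z.re + z.im : ℤ) : ZMod 2) := by
    simp [toZModTwo, Zsqrtd.lift]
  rw [this, ZMod.intCast_zmod_eq_zero_iff_dvd, mem_idealP_iff, even_iff_two_dvd]
  rfl

lemma two_dvd_mul_of_mem_idealP {p q : Zsqrtd (-5)} (hp : p ∈ idealP) (hq : q ∈ idealP) :
    2 ∣ p * q := by
  rw [mem_idealP_iff] at hp hq
  obtain ⟨k, hk⟩ := hp
  obtain ⟨l, hl⟩ := hq
  have h1 : p.re = 2 * k - p.im := by linarith
  have h2 : q.re = 2 * l - q.im := by linarith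
  refine (intCast_dvd 2 (p * q)).mpr ⟨⟨2 * k * l - k * q.im - l * p.im - 2 * p.im * q.im, ?_⟩,
    ⟨k * q.im + l * p.im - p.im * q.im, ?_⟩⟩
  · rw [re_mul, h1, h2]; ring
  · rw [im_mul, h1, h2]; ring

lemma exists_mul_eq_one_add_two_mul {b : Zsqrtd (-5)} (hb : b ∉ idealP) :
    ∃ u k, b * u = 1 + 2 * k := by
  rw [mem_idealP_iff, Int.not_even_iff_odd] at hb
  obtain ⟨k, hk⟩ := hb
  have h1 : b.re = 2 * k + 1 - b.im := by linarith
  -- The norm of `b` is odd, and `m` is half of the norm minus one.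
  obtain ⟨m, hm⟩ : ∃ m : ℤ, m = 2 * k ^ 2 + 2 * k - (2 * k + 1) * b.im + 3 * b.im ^ 2 := ⟨_, rfl⟩
  refine ⟨star b, (m : Zsqrtd (-5)), ?_⟩
  ext
  · simp [h1]; linarith
  · simp; ring

end Zsqrtd

/-! ### The smoothness criterion. -/

namespace QuadraticAlgebraXY

variable {a b c : Zsqrtd (-5)}

lemma smooth_of_idealP (h : b ∉ idealP ∨ (a ∈ idealP ∧ b ∈ idealP ∧ c ∈ idealP)) :
    Algebra.Smooth (Zsqrtd (-5)) (QuadraticAlgebraXY a b c) := by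
  have he := equation a b c
  set F := algebraMap (Zsqrtd (-5)) (QuadraticAlgebraXY a b c)
  set u := x a b c
  set v := y a b c
  let J : Ideal (QuadraticAlgebraXY a b c) :=
    Ideal.span {2 * F a * u + F b * v, F b * u + 2 * F c * v}
  have hx : 2 * F a * u + F b * v ∈ J := Ideal.subset_span (by simp)
  have hy : F b * u + 2 * F c * v ∈ J := Ideal.subset_span (by simp)
  -- Euler's relation for a form of degree two whose value is `1`.
  have h2 : 2 ∈ J := by
    have := add_mem (J.mul_mem_left u hx) (J.mul_mem_left v hy)
    convert this using 1
    linear_combination (-2) * he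
  have h1 : 1 ∈ J := by
    rcases h with hb | ⟨ha, hb, hc⟩
    · obtain ⟨w, k, hk⟩ := Zsqrtd.exists_mul_eq_one_add_two_mul hb
      have hk' := congrArg F hk
      rw [map_add, map_mul, map_mul, map_one, map_ofNat] at hk'
      have hbJ : F b ∈ J := by
        -- Modulo `2` the partial derivatives are `b v` and `b u`, so `b` times the form lies in
        -- `J`; the form equals `1`.
        have e : F b = F a * u * (F b * u + 2 * F c * v) + (F b * u + F c * v) *
            (2 * F a * u + F b * v) - 2 * (2 * F a * F c * u * v + F a * F b * u ^ 2) := by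
          linear_combination (-F b) * he
        rw [e]
        exact sub_mem (add_mem (J.mul_mem_left _ hy) (J.mul_mem_left _ hx)) (J.mul_mem_right _ h2)
      have e : 1 = F b * F w - 2 * F k := by linear_combination -hk'
      rw [e]
      exact sub_mem (J.mul_mem_right _ hbJ) (J.mul_mem_right _ h2)
    · have hmul : ∀ {p q : Zsqrtd (-5)}, p ∈ idealP → q ∈ idealP → F p * F q ∈ J := by
        intro p q hp hq
        obtain ⟨k, hk⟩ := Zsqrtd.two_dvd_mul_of_mem_idealP hp hq
        rw [← map_mul, hk, map_mul, map_ofNat]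
        exact J.mul_mem_right _ h2
      have hrow : ∀ {p : Zsqrtd (-5)}, p ∈ idealP → F p ∈ J := by
        intro p hp
        -- Multiplying the equation by `p` leaves only products of two elements of `P`, which are
        -- multiples of `2`.
        have e : F p = F p * F a * u ^ 2 + F p * F b * (u * v) + F p * F c * v ^ 2 := by
          linear_combination (-F p) * he
        rw [e]
        exact add_mem (add_mem (J.mul_mem_right _ (hmul hp ha)) (J.mul_mem_right _ (hmul hp hb)))
          (J.mul_mem_right _ (hmul hp hc))
      rw [← he]
      exact add_mem (add_mem (J.mul_mem_right _ (hrow ha))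
        (J.mul_mem_right _ (J.mul_mem_right _ (hrow hb)))) (J.mul_mem_right _ (hrow hc))
  obtain ⟨α, β, hαβ⟩ := Ideal.mem_span_pair.mp h1
  exact smooth_of_jacobian hαβ

lemma not_smooth_of_idealP (hb : b ∈ idealP) (h : a ∉ idealP ∨ c ∉ idealP) :
    ¬ Algebra.Smooth (Zsqrtd (-5)) (QuadraticAlgebraXY a b c) := by
  let _ : Algebra (Zsqrtd (-5)) (ZMod 2) := Zsqrtd.toZModTwo.toAlgebra
  have hmap : ∀ z, algebraMap (Zsqrtd (-5)) (ZMod 2) z = Zsqrtd.toZModTwo z := fun _ ↦ rfl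
  have hone : ∀ z, z ∉ idealP → algebraMap (Zsqrtd (-5)) (ZMod 2) z = 1 := fun z hz ↦ by
    rw [← Zsqrtd.toZModTwo_eq_zero_iff] at hz
    rw [hmap]
    generalize Zsqrtd.toZModTwo z = w at hz
    revert w
    decide
  have hb' : algebraMap (Zsqrtd (-5)) (ZMod 2) b = 0 := by
    rwa [hmap, Zsqrtd.toZModTwo_eq_zero_iff]
  rcases h with h | h
  · exact not_smooth_of_charTwo (ZMod 2) hb' (x₀ := 1) (y₀ := 0) (by simp [hone _ h])
  · exact not_smooth_of_charTwo (ZMod 2) hb' (x₀ := 0) (y₀ := 1) (by simp [hone _ h])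

end QuadraticAlgebraXY

/-! ### Regularity in the three cases. -/

open MvPolynomial

lemma Derivation.mem_of_mul_mem_sq {k R : Type*} [CommRing k] [CommRing R] [Algebra k R]
    (D : Derivation k R R) {p : Ideal R} (hp : p.IsPrime) {f s : R} (hf : f ∈ p)
    (h : s * f ∈ p ^ 2) (hs : s ∉ p) : D f ∈ p := by
  have h1 : D (s * f) ∈ p := by
    rw [pow_two] at h
    refine Submodule.mul_induction_on h (fun u hu v hv ↦ ?_) fun u v hu hv ↦ ?_
    · rw [D.leibniz, smul_eq_mul, smul_eq_mul]
      exact add_mem (p.mul_mem_right _ hu) (p.mul_mem_right _ hv)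
    · rw [map_add]; exact add_mem hu hv
  rw [D.leibniz, smul_eq_mul, smul_eq_mul] at h1
  have h2 := (Submodule.add_mem_iff_left _ (p.mul_mem_right (D s) hf)).mp h1
  exact (hp.mem_or_mem h2).resolve_left hs

/-- A uniformizer `ϖ` at a prime above `2` with residue field `𝔽₂` remains a regular parameter in
the local rings of a polynomial ring. The proof uses a lift of Frobenius. -/
lemma MvPolynomial.mem_of_mul_C_mem_sq {B σ : Type*} [CommRing B] [IsDomain B] {ϖ ϖ' : B}
    (hϖ0 : ϖ ≠ 0) (h6 : ϖ * ϖ' = 6) (hfrob : ∀ r : B, ϖ ∣ 3 * (r - r ^ 2))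
    {p : Ideal (MvPolynomial σ B)} (hp : p.IsPrime) (h2p : 2 ∈ p) (hϖ : C ϖ ∈ p)
    {s : MvPolynomial σ B} (h : s * C ϖ ∈ p ^ 2) : s ∈ p := by
  let φ : MvPolynomial σ B →ₐ[B] MvPolynomial σ B := expand 2
  have h6' : (C ϖ * C ϖ' : MvPolynomial σ B) = 6 := by rw [← C_mul, h6, map_ofNat]
  have h3p : ∀ g, 3 * g ∈ p → g ∈ p := fun g hg ↦ by
    have e : g = 3 * g - 2 * g := by ring
    rw [e]; exact sub_mem hg (p.mul_mem_right _ h2p)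
  have hφ : ∀ g, ∃ t, 3 * (φ g - g ^ 2) = C ϖ * t := fun g ↦ by
    induction g using MvPolynomial.induction_on with
    | C r =>
      obtain ⟨t, ht⟩ := hfrob r
      refine ⟨C t, ?_⟩
      rw [show φ (C r) = C r from expand_C 2 r, ← C_mul, ← ht]
      simp only [map_mul, map_sub, map_pow, map_ofNat]
    | add g g' hg hg' =>
      obtain ⟨t, ht⟩ := hg
      obtain ⟨t', ht'⟩ := hg'
      refine ⟨t + t' - C ϖ' * g * g', ?_⟩
      rw [map_add]
      linear_combination ht + ht' + g * g' * h6'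
    | mul_X g i hg =>
      obtain ⟨t, ht⟩ := hg
      refine ⟨t * X i ^ 2, ?_⟩
      rw [map_mul, show φ (X i) = X i ^ 2 from expand_X 2 i]
      linear_combination X i ^ 2 * ht
  have hφp : ∀ g ∈ p, φ g ∈ p := fun g hg ↦ by
    obtain ⟨t, ht⟩ := hφ g
    refine h3p _ ?_
    have e : 3 * φ g = C ϖ * t + g * (3 * g) := by linear_combination ht
    rw [e]
    exact add_mem (p.mul_mem_right _ hϖ) (p.mul_mem_right _ hg)
  -- The quotient `3 (φ g - g ^ 2) / ϖ` plays the role of a derivation: it maps `p ^ 2` into `p`,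
  -- and on `s ϖ` it is `3 φ s` up to an element of `p`. The factor `3`, harmless at `p`, is there
  -- because `ϖ` also divides `6`.
  have key : ∀ g ∈ p * p, g ∈ p ∧ ∃ t ∈ p, 3 * (φ g - g ^ 2) = C ϖ * t := fun g hg ↦ by
    refine Submodule.mul_induction_on hg (fun u hu v hv ↦ ⟨p.mul_mem_right _ hu, ?_⟩)
      fun u v hu hv ↦ ⟨add_mem hu.1 hv.1, ?_⟩
    · obtain ⟨t, ht⟩ := hφ u
      obtain ⟨t', ht'⟩ := hφ v
      refine ⟨φ u * t' + v ^ 2 * t, add_mem (p.mul_mem_right _ (hφp u hu))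
        (p.mul_mem_right _ (Ideal.pow_mem_of_mem p hv 2 two_pos)), ?_⟩
      rw [map_mul]
      linear_combination φ u * ht' + v ^ 2 * ht
    · obtain ⟨-, t, htp, ht⟩ := hu
      obtain ⟨hv, t', htp', ht'⟩ := hv
      refine ⟨t + t' - C ϖ' * u * v, sub_mem (add_mem htp htp') (p.mul_mem_left _ hv), ?_⟩
      rw [map_add]
      linear_combination ht + ht' + u * v * h6'
  rw [pow_two] at h
  obtain ⟨-, t, htp, ht⟩ := key _ h
  rw [map_mul, show φ (C ϖ) = C ϖ from expand_C 2 ϖ] at ht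
  have hC0 : (C ϖ : MvPolynomial σ B) ≠ 0 := by rwa [Ne, C_eq_zero]
  have h1 : 3 * φ s - 3 * s ^ 2 * C ϖ = t := mul_left_cancel₀ hC0 (by linear_combination ht)
  obtain ⟨t', ht'⟩ := hφ s
  refine hp.mem_of_pow_mem 2 (h3p _ ?_)
  have e : 3 * s ^ 2 = t - C ϖ * t' + C ϖ * (3 * s ^ 2) := by linear_combination -ht' + h1
  rw [e]
  exact add_mem (sub_mem htp (p.mul_mem_right _ hϖ)) (p.mul_mem_right _ hϖ)

namespace Zsqrtd

lemma sqrtd_neg_five_mul_self : (sqrtd : Zsqrtd (-5)) * sqrtd = -5 := by ext <;> simp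

lemma one_add_sqrtd_dvd (r : Zsqrtd (-5)) : (1 + sqrtd) ∣ 3 * (r - r ^ 2) := by
  have hp : r - r ^ 2 ∈ idealP := by
    rw [← toZModTwo_eq_zero_iff, map_sub, map_pow]
    generalize toZModTwo r = z
    revert z
    decide
  obtain ⟨u, v, huv⟩ := Ideal.mem_span_pair.mp hp
  -- From `r - r ^ 2 = 2 u + (1 + √-5) v` and `6 = (1 + √-5) (1 - √-5)`.
  refine ⟨u * (1 - sqrtd) + 3 * v, ?_⟩
  linear_combination (-3) * huv + u * sqrtd_neg_five_mul_self

end Zsqrtd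

namespace QuadraticAlgebraXY

variable {a b c : Zsqrtd (-5)}

lemma two_mem_sq {p : Ideal (MvPolynomial (Fin 2) (Zsqrtd (-5)))} (h2 : 2 ∈ p)
    (hπ : C (1 + Zsqrtd.sqrtd) ∈ p) : 2 ∈ p ^ 2 := by
  have hsq : (C Zsqrtd.sqrtd * C Zsqrtd.sqrtd : MvPolynomial (Fin 2) (Zsqrtd (-5))) = -5 := by
    rw [← C_mul, Zsqrtd.sqrtd_neg_five_mul_self, C_neg, map_ofNat]
  rw [pow_two]
  have e : (2 : MvPolynomial (Fin 2) (Zsqrtd (-5))) = 2 * C (1 + Zsqrtd.sqrtd)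
      - C (1 + Zsqrtd.sqrtd) * C (1 + Zsqrtd.sqrtd) - 2 * 2 := by
    rw [C_add, C_1]
    linear_combination hsq
  rw [e]
  exact sub_mem (sub_mem (Ideal.mul_mem_mul h2 hπ) (Ideal.mul_mem_mul hπ hπ))
    (Ideal.mul_mem_mul h2 h2)

/-- Idempotents `ε`, `δ` are `0` or `1`, which treats the cases together. Since `√-5 = π - 1`,
modulo `2` one has `f = π l - g ^ 2` with `g ^ 2 = l + 1`. At a singular prime `p`, `2` and `π` lie
in `p` and `2 ∈ p ^ 2`; so `g ∈ p`, `l ∉ p`, and `π` itself would have to lie in the square of the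
local maximal ideal. -/
lemma isRegularRing_of_dvd {ε δ : Zsqrtd (-5)} (hε : ε ^ 2 = ε) (hδ : δ ^ 2 = δ)
    (ha : 2 ∣ a - ε * Zsqrtd.sqrtd) (hb : 2 ∣ b) (hc : 2 ∣ c - δ * Zsqrtd.sqrtd) :
    IsRegularRing (QuadraticAlgebraXY a b c) := by
  refine IsRegularRing.of_surjective_of_ker_eq_span (Ideal.Quotient.mk _)
    Ideal.Quotient.mk_surjective Ideal.mk_ker fun p hp hfp s hs ↦ ?_
  by_contra hsp
  have hX := (pderiv 0).mem_of_mul_mem_sq hp hfp hs hsp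
  have hY := (pderiv 1).mem_of_mul_mem_sq hp hfp hs hsp
  simp [pderiv_X] at hX hY
  have h2 : (2 : MvPolynomial (Fin 2) (Zsqrtd (-5))) ∈ p := by
    have := sub_mem (add_mem (p.mul_mem_left (X 0) hX) (p.mul_mem_left (X 1) hY))
      (p.mul_mem_left 2 hfp)
    convert this using 1
    ring
  have hsq : (C Zsqrtd.sqrtd * C Zsqrtd.sqrtd : MvPolynomial (Fin 2) (Zsqrtd (-5))) = -5 := by
    rw [← C_mul, Zsqrtd.sqrtd_neg_five_mul_self, C_neg, map_ofNat]
  have hπ : (C (1 + Zsqrtd.sqrtd) : MvPolynomial (Fin 2) (Zsqrtd (-5))) ∈ p := by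
    refine hp.mem_of_pow_mem 2 ?_
    have e : (C (1 + Zsqrtd.sqrtd) : MvPolynomial (Fin 2) (Zsqrtd (-5))) ^ 2 =
        2 * (C Zsqrtd.sqrtd - 2) := by
      rw [C_add, C_1]; linear_combination hsq
    rw [e]; exact p.mul_mem_right _ h2
  have h22 := two_mem_sq h2 hπ
  obtain ⟨a', ha⟩ := ha
  obtain ⟨b', rfl⟩ := hb
  obtain ⟨c', hc⟩ := hc
  obtain rfl := sub_eq_iff_eq_add.mp ha
  obtain rfl := sub_eq_iff_eq_add.mp hc
  have hε' : (C ε : MvPolynomial (Fin 2) (Zsqrtd (-5))) ^ 2 = C ε := by rw [← C_pow, hε]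
  have hδ' : (C δ : MvPolynomial (Fin 2) (Zsqrtd (-5))) ^ 2 = C δ := by rw [← C_pow, hδ]
  let l : MvPolynomial (Fin 2) (Zsqrtd (-5)) := C ε * X 0 ^ 2 + C δ * X 1 ^ 2
  let g : MvPolynomial (Fin 2) (Zsqrtd (-5)) := C ε * X 0 + C δ * X 1 + 1
  let q : MvPolynomial (Fin 2) (Zsqrtd (-5)) := C a' * X 0 ^ 2 + C b' * X 0 * X 1 +
    C c' * X 1 ^ 2 + C ε * C δ * X 0 * X 1 + C ε * X 0 + C δ * X 1
  have h2C : (C 2 : MvPolynomial (Fin 2) (Zsqrtd (-5))) = 2 := map_ofNat C 2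
  have hf : C (2 * a' + ε * Zsqrtd.sqrtd) * X 0 ^ 2 + C (2 * b') * X 0 * X 1 +
      C (2 * c' + δ * Zsqrtd.sqrtd) * X 1 ^ 2 - 1 = C (1 + Zsqrtd.sqrtd) * l - g ^ 2 + 2 * q := by
    simp only [C_add, C_mul, C_1, h2C, l, g, q]
    linear_combination X 0 ^ 2 * hε' + X 1 ^ 2 * hδ'
  rw [hf] at hfp hs
  have hg : g ∈ p := by
    refine hp.mem_of_pow_mem 2 ?_
    have e : g ^ 2 = C (1 + Zsqrtd.sqrtd) * l + 2 * q -
      (C (1 + Zsqrtd.sqrtd) * l - g ^ 2 + 2 * q) := by ring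
    rw [e]
    exact sub_mem (add_mem (p.mul_mem_right _ hπ) (p.mul_mem_right _ h2)) hfp
  have hl : l ∉ p := fun hl ↦ by
    refine hp.ne_top ((Ideal.eq_top_iff_one _).mpr ?_)
    have e : 1 = g * g - l - 2 * (C ε * C δ * X 0 * X 1 + C ε * X 0 + C δ * X 1) := by
      simp only [l, g]
      linear_combination (-X 0 ^ 2) * hε' - X 1 ^ 2 * hδ'
    rw [e]
    exact sub_mem (sub_mem (p.mul_mem_right _ hg) hl) (p.mul_mem_right _ h2)
  have hmem : (s * l) * C (1 + Zsqrtd.sqrtd) ∈ p ^ 2 := by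
    have e : (s * l) * C (1 + Zsqrtd.sqrtd) = s * (C (1 + Zsqrtd.sqrtd) * l - g ^ 2 + 2 * q) +
      s * g ^ 2 - 2 * (s * q) := by ring
    rw [e]
    exact sub_mem (add_mem hs (Ideal.mul_mem_left _ _ (Ideal.pow_mem_pow hg 2)))
      (Ideal.mul_mem_right _ _ h22)
  have h0 : (1 + Zsqrtd.sqrtd : Zsqrtd (-5)) ≠ 0 := fun h ↦ by
    simpa using congrArg Zsqrtd.im h
  have h6 : (1 + Zsqrtd.sqrtd : Zsqrtd (-5)) * (1 - Zsqrtd.sqrtd) = 6 := by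
    linear_combination -Zsqrtd.sqrtd_neg_five_mul_self
  exact (hp.mem_or_mem (mem_of_mul_C_mem_sq h0 h6 Zsqrtd.one_add_sqrtd_dvd hp h2 hπ hmem)).elim
    hsp hl

end QuadraticAlgebraXY

/-! ### Singular points in the remaining cases. -/

lemma IsAlgClosed.exists_quadratic_eq_zero {K : Type*} [Field K] [IsAlgClosed K] {α β γ : K}
    (h : α ≠ 0 ∨ β ≠ 0 ∨ γ = 0) : ∃ z, α * z ^ 2 + β * z + γ = 0 := by
  by_cases hα : α = 0
  · by_cases hβ : β = 0
    · exact ⟨0, by simpa [hα, hβ] using h⟩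
    · exact ⟨-γ / β, by rw [hα]; field_simp; ring⟩
  · obtain ⟨z, hz⟩ := IsAlgClosed.exists_root
      (Polynomial.C α * Polynomial.X ^ 2 + Polynomial.C β * Polynomial.X + Polynomial.C γ)
      (by rw [Polynomial.degree_quadratic hα]; decide)
    exact ⟨z, by simpa using hz⟩

/-- The first two `P`-adic digits, with `1 + √-5` as uniformizer; the remainder lies in `P ^ 2 =
(2)`. -/
lemma Zsqrtd.exists_eq_add_one_add_sqrtd_mul (z : Zsqrtd (-5)) :
    ∃ z₀ z₁ z₂ : Zsqrtd (-5), (z₀ = 0 ∨ z₀ = 1) ∧ (z₁ = 0 ∨ z₁ = 1) ∧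
      z = z₀ + (1 + Zsqrtd.sqrtd) * z₁ + 2 * z₂ := by
  have key : ∀ n : ℤ, ∃ m k : ℤ, (m = 0 ∨ m = 1) ∧ n = m + 2 * k := fun n ↦
    ⟨n % 2, n / 2, by omega, by omega⟩
  obtain ⟨m, k, hm, hk⟩ := key (z.re - z.im)
  obtain ⟨m', k', hm', hk'⟩ := key z.im
  refine ⟨(m : Zsqrtd (-5)), (m' : Zsqrtd (-5)),
    (k : Zsqrtd (-5)) + (1 + sqrtd) * (k' : Zsqrtd (-5)), by exact_mod_cast hm, by exact_mod_cast hm', ?_⟩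
  ext
  · simp; linarith
  · simp; linarith

namespace QuadraticAlgebraXY

/-- At the point `(u, v)` the polynomials `g` and `q` vanish, as do `2` and `π`; with `2 ∈ p ^ 2`,
the decomposition `f = g ^ 2 + π q + 2 r` puts `f` in `p ^ 2`. -/
lemma not_isRegularRing_of_point {K : Type*} [Field K] (ρ : Zsqrtd (-5) →+* K)
    (h2 : (2 : K) = 0) (hπ : ρ (1 + Zsqrtd.sqrtd) = 0)
    {a₀ a₁ a₂ b₁ b₂ c₀ c₁ c₂ : Zsqrtd (-5)} (ha : a₀ ^ 2 = a₀) (hc : c₀ ^ 2 = c₀) {u v : K}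
    (hg : ρ a₀ * u + ρ c₀ * v = 1) (hq : ρ a₁ * u ^ 2 + ρ b₁ * u * v + ρ c₁ * v ^ 2 = 0) :
    ¬ IsRegularRing (QuadraticAlgebraXY (a₀ + (1 + Zsqrtd.sqrtd) * a₁ + 2 * a₂)
      ((1 + Zsqrtd.sqrtd) * b₁ + 2 * b₂) (c₀ + (1 + Zsqrtd.sqrtd) * c₁ + 2 * c₂)) := by
  let ev : MvPolynomial (Fin 2) (Zsqrtd (-5)) →+* K := eval₂Hom ρ ![u, v]
  let p := RingHom.ker ev
  have hp : p.IsPrime := RingHom.ker_isPrime ev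
  have h2p : 2 ∈ p := by rw [RingHom.mem_ker, map_ofNat, h2]
  have hπp : C (1 + Zsqrtd.sqrtd) ∈ p := by
    rw [RingHom.mem_ker]; exact (eval₂Hom_C _ _ _).trans hπ
  have h22 := two_mem_sq h2p hπp
  have ha' : (C a₀ : MvPolynomial (Fin 2) (Zsqrtd (-5))) ^ 2 = C a₀ := by rw [← C_pow, ha]
  have hc' : (C c₀ : MvPolynomial (Fin 2) (Zsqrtd (-5))) ^ 2 = C c₀ := by rw [← C_pow, hc]
  let g : MvPolynomial (Fin 2) (Zsqrtd (-5)) := C a₀ * X 0 + C c₀ * X 1 + 1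
  let q : MvPolynomial (Fin 2) (Zsqrtd (-5)) :=
    C a₁ * X 0 ^ 2 + C b₁ * X 0 * X 1 + C c₁ * X 1 ^ 2
  let r : MvPolynomial (Fin 2) (Zsqrtd (-5)) := C a₂ * X 0 ^ 2 + C b₂ * X 0 * X 1 +
    C c₂ * X 1 ^ 2 - C a₀ * C c₀ * X 0 * X 1 - C a₀ * X 0 - C c₀ * X 1 - 1
  have hgp : g ∈ p := by
    rw [RingHom.mem_ker]
    simp [g, ev, hg, one_add_one_eq_two, h2]
  have hqp : q ∈ p := by
    rw [RingHom.mem_ker]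
    simp [q, ev, hq]
  have h2C : (C 2 : MvPolynomial (Fin 2) (Zsqrtd (-5))) = 2 := map_ofNat C 2
  refine not_isRegularRing_of_mem_sq (Ideal.Quotient.mk _) Ideal.Quotient.mk_surjective ?_
    Ideal.mk_ker p ?_
  · intro h0
    simpa using congrArg (eval 0) h0
  · have e : C (a₀ + (1 + Zsqrtd.sqrtd) * a₁ + 2 * a₂) * X 0 ^ 2 +
        C ((1 + Zsqrtd.sqrtd) * b₁ + 2 * b₂) * X 0 * X 1 +
        C (c₀ + (1 + Zsqrtd.sqrtd) * c₁ + 2 * c₂) * X 1 ^ 2 - 1 =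
        g ^ 2 + C (1 + Zsqrtd.sqrtd) * q + 2 * r := by
      simp only [C_add, C_mul, C_1, h2C, g, q, r]
      linear_combination (-X 0 ^ 2) * ha' - X 1 ^ 2 * hc'
    rw [e]
    refine add_mem (add_mem (Ideal.pow_mem_pow hgp 2) ?_) (Ideal.mul_mem_right _ _ h22)
    rw [pow_two]
    exact Ideal.mul_mem_mul hπp hqp

/-- Over an algebraic closure of `𝔽₂`, the form `q` has no zero on the line `g = 0`. Restricted to a
parameter of the line it is a polynomial of degree at most two without roots, hence a nonzero
constant, which determines all the digits `a₁`, `b₁`, `c₁`. -/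
lemma dvd_of_isRegularRing {a b c : Zsqrtd (-5)} (hb : b ∈ idealP)
    (h : a ∉ idealP ∨ c ∉ idealP) (hreg : IsRegularRing (QuadraticAlgebraXY a b c)) :
    (2 ∣ a - Zsqrtd.sqrtd ∧ 2 ∣ b ∧ 2 ∣ c - Zsqrtd.sqrtd) ∨
      (2 ∣ a ∧ 2 ∣ b ∧ 2 ∣ c - Zsqrtd.sqrtd) ∨
      (2 ∣ a - Zsqrtd.sqrtd ∧ 2 ∣ b ∧ 2 ∣ c) := by
  let K := AlgebraicClosure (ZMod 2)
  let ρ : Zsqrtd (-5) →+* K := (algebraMap (ZMod 2) K).comp Zsqrtd.toZModTwo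
  have hρ : ∀ z ∈ idealP, ρ z = 0 := fun z hz ↦ by
    rw [RingHom.comp_apply, (Zsqrtd.toZModTwo_eq_zero_iff z).mpr hz, map_zero]
  have hπ : 1 + Zsqrtd.sqrtd ∈ idealP := Ideal.subset_span (by simp)
  have h2P : 2 ∈ idealP := Ideal.subset_span (by simp)
  have h2 : (2 : K) = 0 := by rw [← map_ofNat ρ 2]; exact hρ _ h2P
  have hmem : ∀ z z' : Zsqrtd (-5), (1 + Zsqrtd.sqrtd) * z + 2 * z' ∈ idealP := fun z z' ↦
    add_mem (Ideal.mul_mem_right _ _ hπ) (Ideal.mul_mem_right _ _ h2P)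
  obtain ⟨a₀, a₁, a₂, ha₀, ha₁, rfl⟩ := Zsqrtd.exists_eq_add_one_add_sqrtd_mul a
  obtain ⟨b₀, b₁, b₂, hb₀, hb₁, rfl⟩ := Zsqrtd.exists_eq_add_one_add_sqrtd_mul b
  obtain ⟨c₀, c₁, c₂, hc₀, hc₁, rfl⟩ := Zsqrtd.exists_eq_add_one_add_sqrtd_mul c
  obtain rfl : b₀ = 0 := hb₀.resolve_right fun h1 ↦ by
    subst h1
    rw [add_assoc, Submodule.add_mem_iff_left _ (hmem _ _), Zsqrtd.mem_idealP_iff] at hb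
    exact absurd hb (by decide)
  rw [zero_add] at hreg
  have key : ∀ u v : K, ρ a₀ * u + ρ c₀ * v = 1 →
      ρ a₁ * u ^ 2 + ρ b₁ * u * v + ρ c₁ * v ^ 2 ≠ 0 := fun u v hg hq ↦
    not_isRegularRing_of_point ρ h2 (hρ _ hπ) (by rcases ha₀ with rfl | rfl <;> simp)
      (by rcases hc₀ with rfl | rfl <;> simp) hg hq hreg
  rcases ha₀ with rfl | rfl <;> rcases hc₀ with rfl | rfl
  · simp only [zero_add, hmem, not_true_eq_false, or_self] at h
  · have hroot : ¬ (ρ a₁ ≠ 0 ∨ ρ b₁ ≠ 0 ∨ ρ c₁ = 0) := fun hroot ↦ by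
      obtain ⟨z, hz⟩ := IsAlgClosed.exists_quadratic_eq_zero hroot
      exact key z 1 (by simp) (by simpa using hz)
    obtain ⟨rfl, rfl, rfl⟩ : a₁ = 0 ∧ b₁ = 0 ∧ c₁ = 1 := by
      rcases ha₁ with rfl | rfl <;> rcases hb₁ with rfl | rfl <;> rcases hc₁ with rfl | rfl <;>
        simp at hroot ⊢
    -- The shift by `1` comes from `1 + (1 + √-5) = √-5 + 2`.
    exact Or.inr (Or.inl ⟨⟨a₂, by ring⟩, ⟨b₂, by ring⟩, ⟨c₂ + 1, by ring⟩⟩)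
  · have hroot : ¬ (ρ c₁ ≠ 0 ∨ ρ b₁ ≠ 0 ∨ ρ a₁ = 0) := fun hroot ↦ by
      obtain ⟨z, hz⟩ := IsAlgClosed.exists_quadratic_eq_zero hroot
      exact key 1 z (by simp) (by rw [← hz]; ring)
    obtain ⟨rfl, rfl, rfl⟩ : a₁ = 1 ∧ b₁ = 0 ∧ c₁ = 0 := by
      rcases ha₁ with rfl | rfl <;> rcases hb₁ with rfl | rfl <;> rcases hc₁ with rfl | rfl <;>
        simp at hroot ⊢
    exact Or.inr (Or.inr ⟨⟨a₂ + 1, by ring⟩, ⟨b₂, by ring⟩, ⟨c₂, by ring⟩⟩)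
  · have hroot : ¬ (ρ a₁ + ρ b₁ + ρ c₁ ≠ 0 ∨ ρ b₁ ≠ 0 ∨ ρ a₁ = 0) := fun hroot ↦ by
      obtain ⟨z, hz⟩ := IsAlgClosed.exists_quadratic_eq_zero hroot
      -- In characteristic two `(z + 1, z)` parametrizes the line `u + v = 1`, and `q` becomes `(a₁
      -- + b₁ + c₁) z ^ 2 + b₁ z + a₁` there.
      refine key (z + 1) z ?_ ?_
      · rw [map_one]; linear_combination z * h2
      · linear_combination hz + ρ a₁ * z * h2
    obtain ⟨rfl, rfl, rfl⟩ : a₁ = 1 ∧ b₁ = 0 ∧ c₁ = 1 := by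
      rcases ha₁ with rfl | rfl <;> rcases hb₁ with rfl | rfl <;> rcases hc₁ with rfl | rfl <;>
        simp at hroot ⊢
    exact Or.inl ⟨⟨a₂ + 1, by ring⟩, ⟨b₂, by ring⟩, ⟨c₂ + 1, by ring⟩⟩

lemma isRegularRing_and_mem_idealP_of_dvd {a b c : Zsqrtd (-5)}
    (h : (2 ∣ a - Zsqrtd.sqrtd ∧ 2 ∣ b ∧ 2 ∣ c - Zsqrtd.sqrtd) ∨
      (2 ∣ a ∧ 2 ∣ b ∧ 2 ∣ c - Zsqrtd.sqrtd) ∨ (2 ∣ a - Zsqrtd.sqrtd ∧ 2 ∣ b ∧ 2 ∣ c)) :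
    IsRegularRing (QuadraticAlgebraXY a b c) ∧ b ∈ idealP ∧ (a ∉ idealP ∨ c ∉ idealP) := by
  have h2P : 2 ∈ idealP := Ideal.subset_span (by simp)
  have hmem : ∀ z : Zsqrtd (-5), 2 ∣ z → z ∈ idealP := fun z hz ↦ idealP.mem_of_dvd hz h2P
  have hnot : ∀ z : Zsqrtd (-5), 2 ∣ z - Zsqrtd.sqrtd → z ∉ idealP := fun z hz hzP ↦ by
    have := sub_mem hzP (hmem _ hz)
    rw [sub_sub_cancel, Zsqrtd.mem_idealP_iff] at this
    exact absurd this (by decide)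
  rcases h with ⟨ha, hb, hc⟩ | ⟨ha, hb, hc⟩ | ⟨ha, hb, hc⟩
  · exact ⟨isRegularRing_of_dvd (ε := 1) (δ := 1) (by simp) (by simp) (by simpa using ha) hb
      (by simpa using hc), hmem _ hb, Or.inl (hnot _ ha)⟩
  · exact ⟨isRegularRing_of_dvd (ε := 0) (δ := 1) (by simp) (by simp) (by simpa using ha) hb
      (by simpa using hc), hmem _ hb, Or.inr (hnot _ hc)⟩
  · exact ⟨isRegularRing_of_dvd (ε := 1) (δ := 0) (by simp) (by simp) (by simpa using ha) hb
      (by simpa using hc), hmem _ hb, Or.inl (hnot _ ha)⟩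

lemma smooth_iff {a b c : Zsqrtd (-5)} :
    Algebra.Smooth (Zsqrtd (-5)) (QuadraticAlgebraXY a b c) ↔
      b ∉ idealP ∨ (a ∈ idealP ∧ b ∈ idealP ∧ c ∈ idealP) := by
  refine ⟨fun hsm ↦ ?_, smooth_of_idealP⟩
  by_contra! h
  exact not_smooth_of_idealP h.1 (by have := h.2; tauto) hsm

end QuadraticAlgebraXY

open QuadraticAlgebraXY in
theorem mainTheorem4 (a b c : Zsqrtd (-5)) :
    (Algebra.Smooth (Zsqrtd (-5)) (QuadraticAlgebraXY a b c) ↔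
      b ∉ idealP ∨ (a ∈ idealP ∧ b ∈ idealP ∧ c ∈ idealP)) ∧
    ((IsRegularRing (QuadraticAlgebraXY a b c) ∧
        ¬ Algebra.Smooth (Zsqrtd (-5)) (QuadraticAlgebraXY a b c)) ↔
      (2 ∣ a - Zsqrtd.sqrtd ∧ 2 ∣ b ∧ 2 ∣ c - Zsqrtd.sqrtd) ∨
      (2 ∣ a ∧ 2 ∣ b ∧ 2 ∣ c - Zsqrtd.sqrtd) ∨
      (2 ∣ a - Zsqrtd.sqrtd ∧ 2 ∣ b ∧ 2 ∣ c)) := by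
  refine ⟨smooth_iff, fun ⟨hreg, hns⟩ ↦ ?_, fun h ↦ ?_⟩
  · rw [smooth_iff] at hns
    push Not at hns
    exact dvd_of_isRegularRing hns.1 (by have := hns.2; tauto) hreg
  · obtain ⟨hreg, hb, hac⟩ := isRegularRing_and_mem_idealP_of_dvd h
    exact ⟨hreg, not_smooth_of_idealP hb hac⟩
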